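/- Let $K$ be a field. A quasi-Hopf algebra over $K$ is an associative unital $K$-algebra $A$ with algebra homomorphisms $\Delta: A \to A \otimes A$ and $\varepsilon: A \to K$, an invertible $\Phi = \sum_i X_i \otimes Y_i \otimes Z_i \in A^{\otimes 3}$ with $\Phi^{-1} = \sum_i \bar X_i \otimes \bar Y_i \otimes \bar Z_i$, an algebra anti-automorphism $S$ of $A$, and elements $\alpha, \beta \in A$ (not assumed invertible) such that for all $a \in A$, with $\Delta(a) = a_{(1)} \otimes a_{(2)}$, $$(\mathrm{id} \otimes \Delta)\Delta(a)\,\Phi = \Phi\,(\Delta \otimes \mathrm{id})\Delta(a), \qquad (\varepsilon \otimes \mathrm{id})\Delta(a) = a = (\mathrm{id} \otimes \varepsilon)\Delta(a), \qquad (\mathrm{id} \otimes \varepsilon \otimes \mathrm{id})(\Phi) = 1 \otimes 1,$$ $$(\mathrm{id} \otimes \mathrm{id} \otimes \Delta)(\Phi)\,(\Delta \otimes \mathrm{id} \otimes \mathrm{id})(\Phi) = (1 \otimes \Phi)\,(\mathrm{id} \otimes \Delta \otimes \mathrm{id})(\Phi)\,(\Phi \otimes 1),$$ $$S(a_{(1)})\,\alpha\,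 a_{(2)} = \varepsilon(a)\alpha, \quad a_{(1)}\,\beta\, S(a_{(2)}) = \varepsilon(a)\beta, \quad \sum_i X_i \beta S(Y_i) \alpha Z_i = 1 = \sum_i S(\bar X_i) \alpha \bar Y_i \beta S(\bar Z_i).$$ It is quasitriangular if it is endowed with an invertible $R = \sum_l s_l \otimes t_l \in A \otimes A$ such that $\Delta^{\mathrm{cop}}(a) R = R \Delta(a)$ for all $a \in A$, where $\Delta^{\mathrm{cop}}(a) = a_{(2)} \otimes a_{(1)}$, and $$(\Delta \otimes \mathrm{id})(R) = \sum Y_i s_l \bar X_j X_k \otimes Z_i \bar Z_j s_q Y_k \otimes X_i t_l \bar Y_j t_q Z_k, \qquad (\mathrm{id} \otimes \Delta)(R) = \sum \bar Z_i s_l Y_j s_q \bar X_k \otimes \bar X_i X_j t_q \bar Y_k \otimes \bar Y_i t_l Z_j \bar Z_k,$$ the sums running over $i,j,k,l,q$. Put $R' = \sum_l t_l \otimes s_l$, and let $$u = \sum_{i,l} S(\bar Y_i \beta S(\bar Z_i))\, S(t_l)\, \alpha\, s_l \bar X_i$$ be the Drinfel'd element. A ribbon element is a nonzero central $v \in A$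 with $\Delta(v) = R'R\,(v \otimes v)$ and $S(v) = v$. Theorem 2.3. Let $A$ be a quasitriangular quasi-Hopf algebra over $K$. Then every ribbon element $v$ of $A$ is invertible and satisfies $v^{-2} = u\,S(u)$. Consequently, the following two definitions of a ribbon structure, both in terms of the inverse $w = v^{-1}$ of a ribbon element, are equivalent: (a) (Bulacu, Panaite and van Oystaeyen) $w \in A$ is central and invertible, $\Delta(w) = (R'R)^{-1}(w \otimes w)$ and $S(w) = w$; (b) (Altschüler and Coste, in the revised form of their axioms) $w \in A$ is central, $w^2 = u\,S(u)$, $S(w) = w$, $\varepsilon(w) = 1$ and $\Delta(w) = (R'R)^{-1}(w \otimes w)$. That is, an element $w \in A$ satisfies (a) if and only if it satisfies (b); and an invertible $v \in A$ is a ribbon element if and only if $v^{-1}$ satisfies (a). -/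

import Mathlib

open scoped TensorProduct

/-! Three-fold and four-fold tensor powers are nested to the right: `A ⊗ (A ⊗ A)` and
`A ⊗ (A ⊗ (A ⊗ A))`. -/

namespace QuasiHopf

variable (K : Type*) {A : Type*} [Field K] [Ring A] [Algebra K A]

/-- `x ⊗ y ↦ y ⊗ x`; the image of `R` is written `R'`. -/
noncomputable def swap : A ⊗[K] A →ₐ[K] A ⊗[K] A :=
  (Algebra.TensorProduct.comm K A A).toAlgHom

/-- Reassociation `(A ⊗ A) ⊗ B → A ⊗ (A ⊗ B)`. -/
noncomputable def reassoc (B : Type*) [Ring B] [Algebra K B] :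
    (A ⊗[K] A) ⊗[K] B →ₐ[K] A ⊗[K] (A ⊗[K] B) :=
  (Algebra.TensorProduct.assoc K K K A A B).toAlgHom

/-- `x ⊗ y ⊗ z ↦ y ⊗ z ⊗ x`. -/
noncomputable def perm231 : A ⊗[K] (A ⊗[K] A) →ₐ[K] A ⊗[K] (A ⊗[K] A) :=
  (reassoc K A).comp (Algebra.TensorProduct.comm K A (A ⊗[K] A)).toAlgHom

/-- `x ⊗ y ⊗ z ↦ z ⊗ x ⊗ y`. -/
noncomputable def perm312 : A ⊗[K] (A ⊗[K] A) →ₐ[K] A ⊗[K] (A ⊗[K] A) :=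
  (perm231 K).comp (perm231 K)

/-- `x ⊗ y ⊗ z ↦ x ⊗ z ⊗ y`. -/
noncomputable def perm132 : A ⊗[K] (A ⊗[K] A) →ₐ[K] A ⊗[K] (A ⊗[K] A) :=
  Algebra.TensorProduct.map (AlgHom.id K A) (swap K)

/-- `x ⊗ y ⊗ z ↦ y ⊗ x ⊗ z`. -/
noncomputable def perm213 : A ⊗[K] (A ⊗[K] A) →ₐ[K] A ⊗[K] (A ⊗[K] A) :=
  (perm132 K).comp (perm231 K)

/-- `s ⊗ t ↦ s ⊗ t ⊗ 1`. -/
noncomputable def leg12 : A ⊗[K] A →ₐ[K] A ⊗[K] (A ⊗[K] A) :=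
  Algebra.TensorProduct.map (AlgHom.id K A) Algebra.TensorProduct.includeLeft

/-- `s ⊗ t ↦ s ⊗ 1 ⊗ t`. -/
noncomputable def leg13 : A ⊗[K] A →ₐ[K] A ⊗[K] (A ⊗[K] A) :=
  Algebra.TensorProduct.map (AlgHom.id K A) Algebra.TensorProduct.includeRight

/-- `s ⊗ t ↦ 1 ⊗ s ⊗ t`. -/
noncomputable def leg23 : A ⊗[K] A →ₐ[K] A ⊗[K] (A ⊗[K] A) :=
  Algebra.TensorProduct.includeRight

/-- `x ⊗ y ⊗ z ↦ x ⊗ y ⊗ z ⊗ 1`. -/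
noncomputable def leg123 : A ⊗[K] (A ⊗[K] A) →ₐ[K] A ⊗[K] (A ⊗[K] (A ⊗[K] A)) :=
  Algebra.TensorProduct.map (AlgHom.id K A) (leg12 K)

/-- `x ⊗ y ⊗ z ↦ 1 ⊗ x ⊗ y ⊗ z`. -/
noncomputable def leg234 : A ⊗[K] (A ⊗[K] A) →ₐ[K] A ⊗[K] (A ⊗[K] (A ⊗[K] A)) :=
  Algebra.TensorProduct.includeRight

variable {K}

/-- `x ⊗ y ↦ f(x) c g(y)`. -/
noncomputable def contract₂ (f : A →ₗ[K] A) (c : A) (g : A →ₗ[K] A) : A ⊗[K] A →ₗ[K] A :=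
  LinearMap.mul' K A ∘ₗ TensorProduct.map (LinearMap.mulRight K c ∘ₗ f) g

/-- `x ⊗ y ⊗ z ↦ f(x) c g(y) d h(z)`. -/
noncomputable def contract₃ (f : A →ₗ[K] A) (c : A) (g : A →ₗ[K] A) (d : A)
    (h : A →ₗ[K] A) : A ⊗[K] (A ⊗[K] A) →ₗ[K] A :=
  LinearMap.mul' K A ∘ₗ TensorProduct.map (LinearMap.mulRight K c ∘ₗ f) (contract₂ g d h)

end QuasiHopf

open QuasiHopf in
/-- A quasi-bialgebra structure on the associative unital `K`-algebra `A`. -/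
structure QuasiBialgebra (K A : Type*) [Field K] [Ring A] [Algebra K A] where
  /-- the coproduct `Δ` -/
  comul : A →ₐ[K] A ⊗[K] A
  /-- the counit `ε` -/
  counit : A →ₐ[K] K
  /-- the associator, an invertible element of `A ⊗ A ⊗ A` -/
  Φ : (A ⊗[K] (A ⊗[K] A))ˣ
  /-- `(id ⊗ Δ)Δ(a) Φ = Φ (Δ ⊗ id)Δ(a)` -/
  quasi_coassoc : ∀ a : A,
    Algebra.TensorProduct.map (AlgHom.id K A) comul (comul a) * Φ =
      Φ * reassoc K A (Algebra.TensorProduct.map comul (AlgHom.id K A) (comul a))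
  /-- `(id ⊗ id ⊗ Δ)(Φ) (Δ ⊗ id ⊗ id)(Φ) = (1 ⊗ Φ) (id ⊗ Δ ⊗ id)(Φ) (Φ ⊗ 1)` -/
  pentagon :
    Algebra.TensorProduct.map (AlgHom.id K A)
        (Algebra.TensorProduct.map (AlgHom.id K A) comul) Φ *
      reassoc K (A ⊗[K] A)
        (Algebra.TensorProduct.map comul (AlgHom.id K (A ⊗[K] A)) Φ) =
    leg234 K Φ *
      Algebra.TensorProduct.map (AlgHom.id K A)
        ((reassoc K A).comp (Algebra.TensorProduct.map comul (AlgHom.id K A))) Φ *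
      leg123 K Φ
  /-- `(ε ⊗ id)Δ(a) = a` -/
  counit_left : ∀ a : A, Algebra.TensorProduct.lid K A
    (Algebra.TensorProduct.map counit (AlgHom.id K A) (comul a)) = a
  /-- `(id ⊗ ε)Δ(a) = a` -/
  counit_right : ∀ a : A, Algebra.TensorProduct.rid K K A
    (Algebra.TensorProduct.map (AlgHom.id K A) counit (comul a)) = a
  /-- `(id ⊗ ε ⊗ id)(Φ) = 1 ⊗ 1` -/
  counit_assoc : Algebra.TensorProduct.map (AlgHom.id K A)
    ((Algebra.TensorProduct.lid K A).toAlgHom.comp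
      (Algebra.TensorProduct.map counit (AlgHom.id K A))) (Φ : A ⊗[K] (A ⊗[K] A)) =
    (1 : A ⊗[K] A)

open QuasiHopf in
/-- A quasi-Hopf algebra structure on `A`; no invertibility of `α` or `β` is required. -/
structure QuasiHopfAlgebra (K A : Type*) [Field K] [Ring A] [Algebra K A] extends
    QuasiBialgebra K A where
  /-- the antipode `S`, an algebra anti-automorphism -/
  S : A ≃ₗ[K] A
  S_one : S 1 = 1
  S_mul : ∀ a b : A, S (a * b) = S b * S a
  /-- the evaluation element -/
  α : A
  /-- the coevaluation element -/
  β : A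
  /-- `S(a₍₁₎) α a₍₂₎ = ε(a) α` -/
  antipode_left : ∀ a : A,
    contract₂ S.toLinearMap α LinearMap.id (comul a) = counit a • α
  /-- `a₍₁₎ β S(a₍₂₎) = ε(a) β` -/
  antipode_right : ∀ a : A,
    contract₂ LinearMap.id β S.toLinearMap (comul a) = counit a • β
  /-- `∑ X β S(Y) α Z = 1`, where `Φ = ∑ X ⊗ Y ⊗ Z` -/
  duality : contract₃ LinearMap.id β S.toLinearMap α LinearMap.id Φ = 1
  /-- `∑ S(X̄) α Ȳ β S(Z̄) = 1`, where `Φ⁻¹ = ∑ X̄ ⊗ Ȳ ⊗ Z̄` -/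
  duality_inv : contract₃ S.toLinearMap α LinearMap.id β S.toLinearMap
    (↑Φ⁻¹ : A ⊗[K] (A ⊗[K] A)) = 1

open QuasiHopf in
/-- A quasitriangular quasi-Hopf algebra structure on `A`, with R-matrix `R`. -/
structure QuasitriangularQuasiHopfAlgebra (K A : Type*) [Field K] [Ring A] [Algebra K A]
    extends QuasiHopfAlgebra K A where
  /-- the R-matrix, an invertible element of `A ⊗ A` -/
  R : (A ⊗[K] A)ˣ
  /-- `Δᶜᵒᵖ(a) R = R Δ(a)` -/
  quasi_cocomm : ∀ a : A, swap K (comul a) * R = R * comul a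
  /-- `(Δ ⊗ id)(R) = Φ₂₃₁ R₁₃ (Φ⁻¹)₁₃₂ R₂₃ Φ`, where
  `Φ₂₃₁ = ∑ Y ⊗ Z ⊗ X` and `(Φ⁻¹)₁₃₂ = ∑ X̄ ⊗ Z̄ ⊗ Ȳ` -/
  hexagon_left :
    reassoc K A (Algebra.TensorProduct.map comul (AlgHom.id K A) (R : A ⊗[K] A)) =
      perm231 K (Φ : A ⊗[K] (A ⊗[K] A)) * leg13 K (R : A ⊗[K] A) *
        perm132 K (↑Φ⁻¹ : A ⊗[K] (A ⊗[K] A)) * leg23 K (R : A ⊗[K] A) *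
        (Φ : A ⊗[K] (A ⊗[K] A))
  /-- `(id ⊗ Δ)(R) = (Φ⁻¹)₃₁₂ R₁₃ Φ₂₁₃ R₁₂ Φ⁻¹`, where
  `(Φ⁻¹)₃₁₂ = ∑ Z̄ ⊗ X̄ ⊗ Ȳ` and `Φ₂₁₃ = ∑ Y ⊗ X ⊗ Z` -/
  hexagon_right :
    Algebra.TensorProduct.map (AlgHom.id K A) comul (R : A ⊗[K] A) =
      perm312 K (↑Φ⁻¹ : A ⊗[K] (A ⊗[K] A)) * leg13 K (R : A ⊗[K] A) *
        perm213 K (Φ : A ⊗[K] (A ⊗[K] A)) * leg12 K (R : A ⊗[K] A) *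
        (↑Φ⁻¹ : A ⊗[K] (A ⊗[K] A))

namespace QuasitriangularQuasiHopfAlgebra

open QuasiHopf

variable {K A : Type*} [Field K] [Ring A] [Algebra K A]

/-- `∑ S(t) α s`, where `R = ∑ s ⊗ t`. -/
noncomputable def evalTwist (H : QuasitriangularQuasiHopfAlgebra K A) : A :=
  contract₂ H.S.toLinearMap H.α LinearMap.id (swap K (H.R : A ⊗[K] A))

/-- The Drinfel'd element `u = ∑ S(Ȳ β S(Z̄)) S(t) α s X̄`, where `R = ∑ s ⊗ t` and
`Φ⁻¹ = ∑ X̄ ⊗ Ȳ ⊗ Z̄`. -/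
noncomputable def drinfeld (H : QuasitriangularQuasiHopfAlgebra K A) : A :=
  contract₂ H.S.toLinearMap H.evalTwist LinearMap.id
    (TensorProduct.comm K A A
      (TensorProduct.map LinearMap.id (contract₂ LinearMap.id H.β H.S.toLinearMap)
        (↑H.Φ⁻¹ : A ⊗[K] (A ⊗[K] A))))

/-- The double braiding element `R'R`. -/
noncomputable def monodromy (H : QuasitriangularQuasiHopfAlgebra K A) : (A ⊗[K] A)ˣ :=
  Units.map (swap K : A ⊗[K] A →ₐ[K] A ⊗[K] A) H.R * H.R

/-- Ribbon elements. -/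
structure IsRibbon (H : QuasitriangularQuasiHopfAlgebra K A) (v : A) : Prop where
  ne_zero : v ≠ 0
  central : ∀ a : A, v * a = a * v
  comul_eq : H.comul v = (H.monodromy : A ⊗[K] A) * (v ⊗ₜ[K] v)
  S_eq : H.S v = v

/-- Ribbon elements in the inverse convention of Bulacu, Panaite and van Oystaeyen. -/
structure IsRibbonBPO (H : QuasitriangularQuasiHopfAlgebra K A) (w : A) : Prop where
  isUnit : IsUnit w
  central : ∀ a : A, w * a = a * w
  comul_eq : H.comul w = (↑H.monodromy⁻¹ : A ⊗[K] A) * (w ⊗ₜ[K] w)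
  S_eq : H.S w = w

/-- Ribbon elements in the inverse convention, by the revised Altschüler–Coste axioms: a central element
subject to four axioms, the first of which prescribes its square. -/
structure IsRibbonAC (H : QuasitriangularQuasiHopfAlgebra K A) (w : A) : Prop where
  central : ∀ a : A, w * a = a * w
  sq_eq : w ^ 2 = H.drinfeld * H.S H.drinfeld
  S_eq : H.S w = w
  counit_eq : H.counit w = 1
  comul_eq : H.comul w = (↑H.monodromy⁻¹ : A ⊗[K] A) * (w ⊗ₜ[K] w)

end QuasitriangularQuasiHopfAlgebra

/-! ### Leg maps and contractions on pure tensors. -/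

namespace QuasiHopf

section

variable {K A : Type*} [Field K] [Ring A] [Algebra K A]

/-! Write `X = ∑ S(x) α y` for `m = ∑ x ⊗ y`. If `v` is central, `S(v) = v`, `ε(v) = 1` and `Δ(v) =
m (v ⊗ v)`, then the antipode axiom `S(v₁) α v₂ = ε(v) α` reads `α = v² X`. For `m = R'R` one finds
`X = S(u) u α`, so `α = z α` with `z = v² S(u) u` central. Although `α` may fail to be invertible,
`z` can be pulled out of the duality axiom `∑ X β S(Y) α Z = 1`, which gives `z = 1`.

The value of `X` needs two facts about `u`: `u a = S²(a) u`, and `S(α) u = τ`, where `τ = ∑ S(t) α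
s`. The first comes from quasi-coassociativity. The second is a zigzag identity
(`S_α_mul_twistMate`): the functional `a ⊗ b ⊗ c ⊗ d ↦ S(b β S(c) α d) τ a`, applied to the
pentagon, makes all factors disappear except `Φ⁻¹ ⊗ 1`, which yields `S(α) u`, and `1 ⊗ Φ`, which
yields `τ`. Counit normalizations of `Φ` and `R` in the remaining legs are needed on the way.
Finally `S(u) u` is exchanged for `u S(u)` using that both are central. -/

@[simp] lemma swap_tmul (x y : A) : swap K (x ⊗ₜ[K] y) = y ⊗ₜ x := rfl

@[simp] lemma reassoc_tmul {B : Type*} [Ring B] [Algebra K B] (x y : A) (z : B) :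
    reassoc K B ((x ⊗ₜ[K] y) ⊗ₜ[K] z) = x ⊗ₜ (y ⊗ₜ z) := rfl

@[simp] lemma perm231_tmul (x y z : A) :
    perm231 K (x ⊗ₜ[K] (y ⊗ₜ[K] z)) = y ⊗ₜ (z ⊗ₜ x) := rfl

@[simp] lemma perm312_tmul (x y z : A) :
    perm312 K (x ⊗ₜ[K] (y ⊗ₜ[K] z)) = z ⊗ₜ (x ⊗ₜ y) := rfl

@[simp] lemma perm132_tmul (x y z : A) :
    perm132 K (x ⊗ₜ[K] (y ⊗ₜ[K] z)) = x ⊗ₜ (z ⊗ₜ y) := rfl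

@[simp] lemma perm213_tmul (x y z : A) :
    perm213 K (x ⊗ₜ[K] (y ⊗ₜ[K] z)) = y ⊗ₜ (x ⊗ₜ z) := rfl

@[simp] lemma leg12_tmul (x y : A) : leg12 K (x ⊗ₜ[K] y) = x ⊗ₜ (y ⊗ₜ 1) := rfl

@[simp] lemma leg13_tmul (x y : A) : leg13 K (x ⊗ₜ[K] y) = x ⊗ₜ (1 ⊗ₜ y) := rfl

@[simp] lemma leg23_apply (t : A ⊗[K] A) : leg23 K t = 1 ⊗ₜ t := rfl

@[simp] lemma leg123_tmul (x y z : A) :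
    leg123 K (x ⊗ₜ[K] (y ⊗ₜ[K] z)) = x ⊗ₜ (y ⊗ₜ (z ⊗ₜ 1)) := rfl

@[simp] lemma leg234_apply (t : A ⊗[K] (A ⊗[K] A)) : leg234 K t = 1 ⊗ₜ t := rfl

@[simp] lemma contract₂_tmul (f : A →ₗ[K] A) (c : A) (g : A →ₗ[K] A) (x y : A) :
    contract₂ f c g (x ⊗ₜ y) = f x * c * g y := rfl

@[simp] lemma contract₃_tmul (f : A →ₗ[K] A) (c : A) (g : A →ₗ[K] A) (d : A)
    (h : A →ₗ[K] A) (x : A) (m : A ⊗[K] A) :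
    contract₃ f c g d h (x ⊗ₜ m) = f x * c * contract₂ g d h m := rfl

end

end QuasiHopf

/-! ### Counit normalization of the associator. -/

namespace QuasiBialgebra

open QuasiHopf Algebra.TensorProduct

section

variable {K A : Type*} [Field K] [Ring A] [Algebra K A] (H : QuasiBialgebra K A)

/-- `a ⊗ b ↦ ε(a) b`. -/
noncomputable def counitL (B : Type*) [Ring B] [Algebra K B] : A ⊗[K] B →ₐ[K] B :=
  (Algebra.TensorProduct.lid K B).toAlgHom.comp (map H.counit (AlgHom.id K B))

/-- `b ⊗ a ↦ ε(a) b`. -/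
noncomputable def counitR (B : Type*) [Ring B] [Algebra K B] : B ⊗[K] A →ₐ[K] B :=
  (Algebra.TensorProduct.rid K K B).toAlgHom.comp (map (AlgHom.id K B) H.counit)

@[simp] lemma counitL_tmul {B : Type*} [Ring B] [Algebra K B] (a : A) (b : B) :
    H.counitL B (a ⊗ₜ b) = H.counit a • b := rfl

@[simp] lemma counitR_tmul {B : Type*} [Ring B] [Algebra K B] (a : A) (b : B) :
    H.counitR B (b ⊗ₜ a) = H.counit a • b := rfl

@[simp] lemma counitL_comul (a : A) : H.counitL A (H.comul a) = a := H.counit_left a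

@[simp] lemma counitR_comul (a : A) : H.counitR A (H.comul a) = a := H.counit_right a

lemma counit_leg2 : map (AlgHom.id K A) (H.counitL A) (H.Φ : A ⊗[K] (A ⊗[K] A)) = 1 :=
  H.counit_assoc

/-- `(ε ⊗ id ⊗ id)(Φ) = 1 ⊗ 1`. -/
lemma counit_leg1 : H.counitL (A ⊗[K] A) (H.Φ : A ⊗[K] (A ⊗[K] A)) = 1 := by
  -- `ε` on the second leg of the pentagon leaves `Φ = (1 ⊗ (ε ⊗ id ⊗ id)(Φ)) Φ`.
  let e := map (AlgHom.id K A) (H.counitL (A ⊗[K] A))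
  have hC : ∀ w : A ⊗[K] (A ⊗[K] A), e (map (AlgHom.id K A) (map (AlgHom.id K A) H.comul) w) =
      map (AlgHom.id K A) H.comul (map (AlgHom.id K A) (H.counitL A) w) := fun w =>
    DFunLike.congr_fun (show e.comp (map (AlgHom.id K A) (map (AlgHom.id K A) H.comul)) =
      (map (AlgHom.id K A) H.comul).comp (map (AlgHom.id K A) (H.counitL A)) by
        ext <;> simp [e]) w
  have hD' : ∀ w, e (reassoc K (A ⊗[K] A) w) = map (H.counitR A) (AlgHom.id K _) w := fun w =>
    DFunLike.congr_fun (show e.comp (reassoc K (A ⊗[K] A)) =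
      map (H.counitR A) (AlgHom.id K _) by ext <;> simp [e, one_def]) w
  have hD : ∀ w, e (reassoc K (A ⊗[K] A) (map H.comul (AlgHom.id K _) w)) = w := fun w => by
    rw [hD']
    induction w with
    | zero => simp
    | add x y hx hy => simp only [map_add, hx, hy]
    | tmul x y => simp
  have hM : ∀ w, e (map (AlgHom.id K A)
      ((reassoc K A).comp (map H.comul (AlgHom.id K A))) w) = w := fun w => by
    have h1 : ∀ t, H.counitL (A ⊗[K] A) (reassoc K A t) = map (H.counitL A) (AlgHom.id K A) t :=
      fun t => DFunLike.congr_fun (show (H.counitL (A ⊗[K] A)).comp (reassoc K A) =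
        map (H.counitL A) (AlgHom.id K A) by ext <;> simp [one_def, TensorProduct.smul_tmul']) t
    have h2 : ∀ t, H.counitL (A ⊗[K] A) (reassoc K A (map H.comul (AlgHom.id K A) t)) = t :=
      fun t => by
        rw [h1]
        induction t with
        | zero => simp
        | add x y hx hy => simp only [map_add, hx, hy]
        | tmul x y => simp
    induction w with
    | zero => simp
    | add x y hx hy => simp only [map_add, hx, hy]
    | tmul x y => simp [e, h2]
  have hG : ∀ w, e (leg123 K w) = leg12 K (map (AlgHom.id K A) (H.counitL A) w) := fun w =>
    DFunLike.congr_fun (show e.comp (leg123 K) =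
      (leg12 K).comp (map (AlgHom.id K A) (H.counitL A)) by
        ext <;> simp [e, one_def]) w
  have h := congrArg e H.pentagon
  rw [map_mul, map_mul, map_mul, hC, hD, hM, hG, H.counit_leg2, map_one, map_one, one_mul,
    mul_one] at h
  have h3 : e (leg234 K H.Φ) = 1 := by
    simpa using congrArg (· * (↑H.Φ⁻¹ : A ⊗[K] (A ⊗[K] A))) h.symm
  simpa [e] using congrArg (H.counitL (A ⊗[K] A)) h3

/-- `(id ⊗ id ⊗ ε)(Φ) = 1 ⊗ 1`. -/
lemma counit_leg3 : map (AlgHom.id K A) (H.counitR A) (H.Φ : A ⊗[K] (A ⊗[K] A)) = 1 := by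
  -- `ε` on the third leg leaves `Φ = Φ ((id ⊗ id ⊗ ε)(Φ) ⊗ 1)`.
  let e := map (AlgHom.id K A) (map (AlgHom.id K A) (H.counitL A))
  have hC : ∀ w : A ⊗[K] (A ⊗[K] A),
      e (map (AlgHom.id K A) (map (AlgHom.id K A) H.comul) w) = w := fun w =>
    DFunLike.congr_fun (show e.comp (map (AlgHom.id K A) (map (AlgHom.id K A) H.comul)) =
      AlgHom.id K _ by ext <;> simp [e]) w
  have hD : ∀ w, e (reassoc K (A ⊗[K] A) (map H.comul (AlgHom.id K _) w)) =
      reassoc K A (map H.comul (AlgHom.id K A) (map (AlgHom.id K A) (H.counitL A) w)) := fun w => by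
    have h1 : ∀ t : (A ⊗[K] A) ⊗[K] (A ⊗[K] A), e (reassoc K (A ⊗[K] A) t) =
        reassoc K A (map (AlgHom.id K _) (H.counitL A) t) := fun t =>
      DFunLike.congr_fun (show e.comp (reassoc K (A ⊗[K] A)) =
        (reassoc K A).comp (map (AlgHom.id K _) (H.counitL A)) by ext <;> simp [e, one_def]) t
    rw [h1]
    induction w with
    | zero => simp
    | add x y hx hy => simp only [map_add, hx, hy]
    | tmul x y => simp
  have hM : ∀ w, e (map (AlgHom.id K A)
      ((reassoc K A).comp (map H.comul (AlgHom.id K A))) w) = w := fun w => by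
    have h1 : ∀ t, map (AlgHom.id K A) (H.counitL A) (reassoc K A t) =
        map (H.counitR A) (AlgHom.id K A) t :=
      fun t => DFunLike.congr_fun (show (map (AlgHom.id K A) (H.counitL A)).comp (reassoc K A) =
        map (H.counitR A) (AlgHom.id K A) by ext <;> simp [one_def]) t
    have h2 : ∀ t, map (AlgHom.id K A) (H.counitL A)
        (reassoc K A (map H.comul (AlgHom.id K A) t)) = t :=
      fun t => by
        rw [h1]
        induction t with
        | zero => simp
        | add x y hx hy => simp only [map_add, hx, hy]
        | tmul x y => simp
    induction w with
    | zero => simp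
    | add x y hx hy => simp only [map_add, hx, hy]
    | tmul x y => simp [e, h2]
  have hG : ∀ w, e (leg123 K w) = leg12 K (map (AlgHom.id K A) (H.counitR A) w) := fun w =>
    DFunLike.congr_fun (show e.comp (leg123 K) =
      (leg12 K).comp (map (AlgHom.id K A) (H.counitR A)) by
        ext <;> simp [e, one_def]) w
  have h := congrArg e H.pentagon
  have hF : e (leg234 K H.Φ) = 1 := by
    have := H.counit_leg2
    simp only [e, leg234_apply, map_tmul, map_one, this]
    rfl
  rw [map_mul, map_mul, map_mul, hC, hD, hM, hG, H.counit_leg2, map_one, map_one, mul_one,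
    hF, one_mul] at h
  have h3 : leg12 K (map (AlgHom.id K A) (H.counitR A) (H.Φ : A ⊗[K] (A ⊗[K] A))) = 1 := by
    simpa using congrArg ((↑H.Φ⁻¹ : A ⊗[K] (A ⊗[K] A)) * ·) h.symm
  have h4 : ∀ t, map (AlgHom.id K A) (H.counitR A) (leg12 K t) = t := fun t =>
    DFunLike.congr_fun (show (map (AlgHom.id K A) (H.counitR A)).comp (leg12 K) =
      AlgHom.id K _ by ext <;> simp) t
  rw [← h4 (map (AlgHom.id K A) (H.counitR A) _), h3, map_one]

lemma map_inv_eq_one {R S F : Type*} [Monoid R] [Monoid S] [FunLike F R S] [MonoidHomClass F R S]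
    (f : F) (x : Rˣ) (h : f x = 1) : f (↑x⁻¹ : R) = 1 := by
  have := congrArg f x.mul_inv
  rwa [map_mul, h, one_mul, map_one] at this

end

end QuasiBialgebra

/-! ### Counit normalization of the R-matrix. -/

namespace QuasitriangularQuasiHopfAlgebra

open QuasiHopf Algebra.TensorProduct

section

variable {K A : Type*} [Field K] [Ring A] [Algebra K A] (H : QuasitriangularQuasiHopfAlgebra K A)

/-- `(ε ⊗ id)(R) = 1`. -/
lemma counitL_R : H.counitL A (H.R : A ⊗[K] A) = 1 := by
  -- `ε` on the first leg of `hexagon_left` kills the associators and leaves `R = (1 ⊗ (ε ⊗ id)(R))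
  -- R`.
  let e := H.counitL (A ⊗[K] A)
  have h1 : ∀ t, e (reassoc K A (map H.comul (AlgHom.id K A) t)) = t := fun t => by
    have h1 : ∀ t, e (reassoc K A t) = map (H.counitL A) (AlgHom.id K A) t :=
      fun t => DFunLike.congr_fun (show e.comp (reassoc K A) =
        map (H.counitL A) (AlgHom.id K A) by
          ext <;> simp [e, one_def, TensorProduct.smul_tmul']) t
    rw [h1]
    induction t with
    | zero => simp
    | add x y hx hy => simp only [map_add, hx, hy]
    | tmul x y => simp
  have h2 : ∀ w, e (perm231 K w) = swap K (map (AlgHom.id K A) (H.counitL A) w) := fun w =>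
    DFunLike.congr_fun (show e.comp (perm231 K) =
      (swap K).comp (map (AlgHom.id K A) (H.counitL A)) by
        ext <;> simp [e, one_def, TensorProduct.smul_tmul']) w
  have h3 : ∀ w, e (perm132 K w) = swap K (e w) := fun w =>
    DFunLike.congr_fun (show e.comp (perm132 K) = (swap K).comp e by
        ext <;> simp [e, one_def, TensorProduct.smul_tmul']) w
  have h4 : ∀ t, e (leg13 K t) = 1 ⊗ₜ (H.counitL A t) := fun t =>
    DFunLike.congr_fun (show e.comp (leg13 K) = includeRight.comp (H.counitL A) by
        ext <;> simp [e]) t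
  have h := congrArg e H.hexagon_left
  have h5 : e (H.Φ : A ⊗[K] (A ⊗[K] A)) = 1 := H.counit_leg1
  rw [map_mul, map_mul, map_mul, map_mul, h1, h2, h3, h4, H.counit_leg2, h5,
    QuasiBialgebra.map_inv_eq_one e _ h5, map_one, one_mul, mul_one, mul_one] at h
  have h6 : (1 : A) ⊗ₜ[K] (H.counitL A (H.R : A ⊗[K] A)) = 1 := by
    simpa [e] using congrArg (· * (↑H.R⁻¹ : A ⊗[K] A)) h.symm
  simpa using congrArg (H.counitL A) h6

/-- `(id ⊗ ε)(R) = 1`. -/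
lemma counitR_R : H.counitR A (H.R : A ⊗[K] A) = 1 := by
  -- `ε` on the third leg of `hexagon_right` leaves `R = ((id ⊗ ε)(R) ⊗ 1) R`.
  let e := map (AlgHom.id K A) (H.counitR A)
  have h1 : ∀ t, e (map (AlgHom.id K A) H.comul t) = t := fun t =>
    DFunLike.congr_fun (show e.comp (map (AlgHom.id K A) H.comul) = AlgHom.id K _ by
      ext <;> simp [e]) t
  have h2 : ∀ w, e (perm312 K w) = swap K (map (AlgHom.id K A) (H.counitL A) w) := fun w =>
    DFunLike.congr_fun (show e.comp (perm312 K) =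
      (swap K).comp (map (AlgHom.id K A) (H.counitL A)) by
        ext <;> simp [e, one_def, TensorProduct.smul_tmul']) w
  have h3 : ∀ w, e (perm213 K w) = swap K (e w) := fun w =>
    DFunLike.congr_fun (show e.comp (perm213 K) = (swap K).comp e by
        ext <;> simp [e, one_def, TensorProduct.smul_tmul']) w
  have h4 : ∀ t, e (leg13 K t) = (H.counitR A t) ⊗ₜ 1 := fun t =>
    DFunLike.congr_fun (show e.comp (leg13 K) =
      (includeLeft : A →ₐ[K] A ⊗[K] A).comp (H.counitR A) by
        ext <;> simp [e, TensorProduct.smul_tmul']) t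
  have h4' : ∀ t, e (leg12 K t) = t := fun t =>
    DFunLike.congr_fun (show e.comp (leg12 K) = AlgHom.id K _ by
        ext <;> simp [e]) t
  have h := congrArg e H.hexagon_right
  have h5 : e (H.Φ : A ⊗[K] (A ⊗[K] A)) = 1 := H.counit_leg3
  rw [map_mul, map_mul, map_mul, map_mul, h1, h2, h3, h4, h4',
    QuasiBialgebra.map_inv_eq_one _ _ H.counit_leg2, h5,
    QuasiBialgebra.map_inv_eq_one e _ h5, map_one, one_mul, mul_one, mul_one] at h
  have h6 : (H.counitR A (H.R : A ⊗[K] A)) ⊗ₜ[K] (1 : A) = 1 := by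
    simpa using congrArg (· * (↑H.R⁻¹ : A ⊗[K] A)) h.symm
  simpa using congrArg (H.counitR A) h6

end

end QuasitriangularQuasiHopfAlgebra

/-! ### Linearity of contractions in their middle elements. -/

namespace QuasiHopf

section

variable {K A : Type*} [Field K] [Ring A] [Algebra K A]

lemma contract₂_smul (f : A →ₗ[K] A) (k : K) (c : A) (g : A →ₗ[K] A) (t : A ⊗[K] A) :
    contract₂ f (k • c) g t = k • contract₂ f c g t := by
  induction t with
  | zero => simp
  | add x y hx hy => simp only [map_add, smul_add, hx, hy]
  | tmul x y => simp

lemma contract₃_central_mul (f g h : A →ₗ[K] A) (c d z : A) (hz : ∀ a, z * a = a * z)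
    (t : A ⊗[K] (A ⊗[K] A)) :
    contract₃ f c g (z * d) h t = z * contract₃ f c g d h t := by
  have h2 : ∀ s, contract₂ g (z * d) h s = z * contract₂ g d h s := fun s => by
    induction s with
    | zero => simp
    | add x y hx hy => simp only [map_add, mul_add, hx, hy]
    | tmul x y =>
      simp only [contract₂_tmul, ← mul_assoc]
      rw [hz (g x)]
  induction t with
  | zero => simp
  | add x y hx hy => simp only [map_add, mul_add, hx, hy]
  | tmul x m => rw [contract₃_tmul, h2, contract₃_tmul, ← mul_assoc, ← hz, mul_assoc]

end

end QuasiHopf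

/-! ### Contractions with the antipode and the zigzag relation. -/

namespace QuasiHopfAlgebra

open QuasiHopf Algebra.TensorProduct

section

variable {K A : Type*} [Field K] [Ring A] [Algebra K A] (H : QuasiHopfAlgebra K A)

/-- `S` reverses products, so the left factor is contracted first, innermost. Hence `α` absorbs a
coproduct standing on the left, and dually `β` absorbs one standing on the right. -/
lemma contract_mul_left (c : A) (x y : A ⊗[K] A) :
    contract₂ H.S.toLinearMap c LinearMap.id (x * y) =
      contract₂ H.S.toLinearMap (contract₂ H.S.toLinearMap c LinearMap.id x) LinearMap.id y := by
  induction y with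
  | zero => simp
  | add y z hy hz => simp only [mul_add, map_add, hy, hz]
  | tmul p q =>
    induction x with
    | zero => simp
    | add y z hy hz => simpa [add_mul, mul_add] using congrArg₂ (· + ·) hy hz
    | tmul a b => simp [H.S_mul, mul_assoc]

lemma contract_mul_right (c : A) (x y : A ⊗[K] A) :
    contract₂ LinearMap.id c H.S.toLinearMap (x * y) =
      contract₂ LinearMap.id (contract₂ LinearMap.id c H.S.toLinearMap y) H.S.toLinearMap x := by
  induction x with
  | zero => simp
  | add y z hy hz => simp only [add_mul, map_add, hy, hz]
  | tmul p q =>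
    induction y with
    | zero => simp
    | add y z hy hz => simpa [add_mul, mul_add] using congrArg₂ (· + ·) hy hz
    | tmul a b => simp [H.S_mul, mul_assoc]

lemma contract_comul_mul (a : A) (y : A ⊗[K] A) :
    contract₂ H.S.toLinearMap H.α LinearMap.id (H.comul a * y) =
      H.counit a • contract₂ H.S.toLinearMap H.α LinearMap.id y := by
  rw [contract_mul_left, H.antipode_left, contract₂_smul]

lemma contract_mul_comul (a : A) (x : A ⊗[K] A) :
    contract₂ LinearMap.id H.β H.S.toLinearMap (x * H.comul a) =
      H.counit a • contract₂ LinearMap.id H.β H.S.toLinearMap x := by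
  rw [contract_mul_right, H.antipode_right, contract₂_smul]

/-- A central left factor of `α` has a right inverse. -/
lemma mul_contract_eq_one_of_α_eq {z y : A} (hz : ∀ a, z * a = a * z) (h : H.α = z * y) :
    z * contract₃ LinearMap.id H.β H.S.toLinearMap y LinearMap.id H.Φ = 1 := by
  rw [← contract₃_central_mul _ _ _ _ _ _ hz, ← h, H.duality]

section

variable {B : Type*} [Ring B] [Algebra K B]

/-- `a ⊗ m ↦ S(G(m)) τ a`. -/
noncomputable def mate (G : B →ₗ[K] A) (τ : A) : A ⊗[K] B →ₗ[K] A :=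
  contract₂ H.S.toLinearMap τ LinearMap.id ∘ₗ (TensorProduct.comm K A A).toLinearMap ∘ₗ
    TensorProduct.map LinearMap.id G

@[simp] lemma mate_tmul (G : B →ₗ[K] A) (τ a : A) (m : B) :
    H.mate G τ (a ⊗ₜ m) = H.S (G m) * τ * a := rfl

variable {C E : Type*} [Ring C] [Algebra K C] [Ring E] [Algebra K E]

/-- Here `f` inserts a coproduct and `p` the counit in the same leg. If `G` cannot distinguish the
two, a factor normalized under `p` is invisible. The next lemma is the version for left factors. -/
lemma mate_mul_map {G : C →ₗ[K] A} {f : B →ₐ[K] C} {p : B →ₐ[K] E} {g : E →ₐ[K] C}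
    (h : ∀ m t, G (m * f t) = G (m * g (p t))) (τ : A) {w : A ⊗[K] B}
    (hw : map (AlgHom.id K A) p w = 1) (y : A ⊗[K] C) :
    H.mate G τ (y * map (AlgHom.id K A) f w) = H.mate G τ y := by
  have key : H.mate G τ (y * map (AlgHom.id K A) f w) =
      H.mate G τ (y * map (AlgHom.id K A) g (map (AlgHom.id K A) p w)) := by
    clear hw
    induction w with
    | zero => simp
    | add x z hx hz => simp only [mul_add, map_add, hx, hz]
    | tmul a t =>
      induction y with
      | zero => simp
      | add x z hx hz => simp only [add_mul, map_add, hx, hz]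
      | tmul b m => simp [h]
  rw [key, hw, map_one, mul_one]

lemma mate_map_mul {G : C →ₗ[K] A} {f : B →ₐ[K] C} {p : B →ₐ[K] E} {g : E →ₐ[K] C}
    (h : ∀ t m, G (f t * m) = G (g (p t) * m)) (τ : A) {w : A ⊗[K] B}
    (hw : map (AlgHom.id K A) p w = 1) (y : A ⊗[K] C) :
    H.mate G τ (map (AlgHom.id K A) f w * y) = H.mate G τ y := by
  have key : H.mate G τ (map (AlgHom.id K A) f w * y) =
      H.mate G τ (map (AlgHom.id K A) g (map (AlgHom.id K A) p w) * y) := by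
    clear hw
    induction w with
    | zero => simp
    | add x z hx hz => simp only [add_mul, map_add, hx, hz]
    | tmul a t =>
      induction y with
      | zero => simp
      | add x z hx hz => simp only [mul_add, map_add, hx, hz]
      | tmul b m => simp [h]
  rw [key, hw, map_one, one_mul]

/-- By `hG` the component `p₂` leaves `G` and passes through `S` to meet `τ`, producing `S(p₂) τ p₁
= ε(p) τ`. -/
lemma mate_comul_mul {G : A ⊗[K] B →ₗ[K] A} (hG : ∀ q z, G (q ⊗ₜ 1 * z) = q * G z) {τ : A}
    (hτ : ∀ a, contract₂ H.S.toLinearMap τ LinearMap.id (swap K (H.comul a)) = H.counit a • τ)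
    {w : A ⊗[K] B} (hw : H.counitL B w = 1) (y : A ⊗[K] (A ⊗[K] B)) :
    H.mate G τ (reassoc K B (map H.comul (AlgHom.id K B) w) * y) = H.mate G τ y := by
  have hs : ∀ (s : A ⊗[K] A) (n : B) (a : A) (z : A ⊗[K] B),
      H.mate G τ (reassoc K B (s ⊗ₜ n) * (a ⊗ₜ z)) =
        H.S (G (1 ⊗ₜ n * z)) * contract₂ H.S.toLinearMap τ LinearMap.id (swap K s) * a :=
    fun s n a z => by
      induction s with
      | zero => simp
      | add x y hx hy => simp only [TensorProduct.add_tmul, add_mul, mul_add, map_add, hx, hy]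
      | tmul p q =>
        have : G (q ⊗ₜ n * z) = q * G (1 ⊗ₜ n * z) := by
          rw [← hG, ← mul_assoc, tmul_mul_tmul, mul_one, one_mul]
        simp [this, H.S_mul, mul_assoc]
  have key : H.mate G τ (reassoc K B (map H.comul (AlgHom.id K B) w) * y) =
      H.mate G τ (1 ⊗ₜ (1 ⊗ₜ H.counitL B w) * y) := by
    clear hw
    induction w with
    | zero => simp
    | add x z hx hz => simp only [TensorProduct.tmul_add, add_mul, map_add, hx, hz]
    | tmul p n =>
      induction y with
      | zero => simp
      | add x z hx hz => simp only [mul_add, map_add, hx, hz]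
      | tmul a z =>
        have h1 : G (1 ⊗ₜ (H.counit p • n) * z) = H.counit p • G (1 ⊗ₜ n * z) := by
          rw [TensorProduct.tmul_smul, smul_mul_assoc, map_smul]
        rw [QuasiBialgebra.counitL_tmul, map_tmul, AlgHom.id_apply, hs, hτ, tmul_mul_tmul, mate_tmul, h1]
        simp
  rw [key, hw, ← one_def, ← one_def, one_mul]

end

/-- `a ⊗ b ⊗ c ↦ S(b β S(c)) τ a`. -/
noncomputable def twistMate (τ : A) : A ⊗[K] (A ⊗[K] A) →ₗ[K] A :=
  H.mate (contract₂ LinearMap.id H.β H.S.toLinearMap) τ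

@[simp] lemma twistMate_tmul (τ a : A) (m : A ⊗[K] A) : H.twistMate τ (a ⊗ₜ m) =
    H.S (contract₂ LinearMap.id H.β H.S.toLinearMap m) * τ * a := rfl

lemma twistMate_mul_comul (τ : A) (w : A ⊗[K] (A ⊗[K] A)) (t : A ⊗[K] A) :
    H.twistMate τ (w * map (AlgHom.id K A) H.comul t) =
      H.twistMate τ w * H.counitR A t := by
  induction t with
  | zero => simp
  | add y z hy hz => simp only [mul_add, map_add, hy, hz]
  | tmul p q =>
    induction w with
    | zero => simp
    | add y z hy hz => simp only [add_mul, map_add, hy, hz]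
    | tmul a m => simp [contract_mul_comul, mul_assoc]

lemma twistMate_comul_mul {τ : A}
    (hτ : ∀ a, contract₂ H.S.toLinearMap τ LinearMap.id (swap K (H.comul a)) = H.counit a • τ)
    (t : A ⊗[K] A) (w : A ⊗[K] (A ⊗[K] A)) :
    H.twistMate τ (reassoc K A (map H.comul (AlgHom.id K A) t) * w) =
      H.S (H.S (H.counitL A t)) * H.twistMate τ w := by
  have key : ∀ (s : A ⊗[K] A) (q a b c : A),
      H.twistMate τ (reassoc K A (s ⊗ₜ q) * (a ⊗ₜ (b ⊗ₜ c))) =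
        H.S (H.S (q * c)) * H.S H.β * H.S b *
          contract₂ H.S.toLinearMap τ LinearMap.id (swap K s) * a := fun s q a b c => by
    induction s with
    | zero => simp
    | add y z hy hz => simp only [TensorProduct.add_tmul, add_mul, mul_add, map_add, hy, hz]
    | tmul x y => simp [H.S_mul, mul_assoc]
  induction t with
  | zero => simp
  | add y z hy hz => simp only [add_mul, map_add, hy, hz]
  | tmul p q =>
    induction w with
    | zero => simp
    | add y z hy hz => simp only [mul_add, map_add, hy, hz]
    | tmul a m =>
      induction m with
      | zero => simp
      | add y z hy hz => simp only [TensorProduct.tmul_add, mul_add, map_add, hy, hz]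
      | tmul b c =>
        rw [map_tmul, AlgHom.id_apply, key, hτ]
        simp [H.S_mul, mul_assoc]

/-- Quasi-coassociativity moves `Δ`-factors across `Φ⁻¹`. On the right, `β` absorbs the inner
coproduct and `a` survives; on the left, `τ` absorbs it and `S²(a)` survives. -/
lemma twistMate_mul {τ : A}
    (hτ : ∀ a, contract₂ H.S.toLinearMap τ LinearMap.id (swap K (H.comul a)) = H.counit a • τ)
    (a : A) : H.twistMate τ (↑H.Φ⁻¹ : A ⊗[K] (A ⊗[K] A)) * a =
    H.S (H.S a) * H.twistMate τ (↑H.Φ⁻¹ : A ⊗[K] (A ⊗[K] A)) := by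
  have h : (↑H.Φ⁻¹ : A ⊗[K] (A ⊗[K] A)) * map (AlgHom.id K A) H.comul (H.comul a) =
      reassoc K A (map H.comul (AlgHom.id K A) (H.comul a)) * (↑H.Φ⁻¹ : A ⊗[K] (A ⊗[K] A)) := by
    rw [Units.inv_mul_eq_iff_eq_mul, ← mul_assoc, ← H.quasi_coassoc, mul_assoc, Units.mul_inv,
      mul_one]
  simpa [twistMate_mul_comul, H.twistMate_comul_mul hτ] using congrArg (H.twistMate τ) h

lemma contract₃_comul_mul (t : A ⊗[K] A) (m : A ⊗[K] (A ⊗[K] A)) :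
    contract₃ LinearMap.id H.β H.S.toLinearMap H.α LinearMap.id
        (map (AlgHom.id K A) H.comul t * m) =
      contract₃ LinearMap.id H.β H.S.toLinearMap H.α LinearMap.id
        ((includeLeft : A →ₐ[K] A ⊗[K] (A ⊗[K] A)) (H.counitR A t) * m) := by
  induction t with
  | zero => simp
  | add y z hy hz => simp only [add_mul, map_add, hy, hz]
  | tmul q r =>
    induction m with
    | zero => simp
    | add y z hy hz => simp only [mul_add, map_add, hy, hz]
    | tmul b n => simp [contract_comul_mul]

lemma contract₃_mul_comul (m : A ⊗[K] (A ⊗[K] A)) (t : A ⊗[K] A) :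
    contract₃ LinearMap.id H.β H.S.toLinearMap H.α LinearMap.id
        (m * (reassoc K A).comp (map H.comul (AlgHom.id K A)) t) =
      contract₃ LinearMap.id H.β H.S.toLinearMap H.α LinearMap.id
        (m * (includeRight : A ⊗[K] A →ₐ[K] A ⊗[K] (A ⊗[K] A)).comp
          (includeRight : A →ₐ[K] A ⊗[K] A) (H.counitL A t)) := by
  have key : ∀ (s : A ⊗[K] A) (r b c d : A),
      contract₃ LinearMap.id H.β H.S.toLinearMap H.α LinearMap.id
        ((b ⊗ₜ (c ⊗ₜ d)) * reassoc K A (s ⊗ₜ r)) =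
      contract₂ LinearMap.id H.β H.S.toLinearMap ((b ⊗ₜ c) * s) * H.α * (d * r) :=
    fun s r b c d => by
      induction s with
      | zero => simp
      | add y z hy hz => simp only [TensorProduct.add_tmul, add_mul, mul_add, map_add, hy, hz]
      | tmul x y => simp [mul_assoc]
  induction t with
  | zero => simp
  | add y z hy hz => simp only [mul_add, map_add, hy, hz]
  | tmul q r =>
    induction m with
    | zero => simp
    | add y z hy hz => simp only [add_mul, map_add, hy, hz]
    | tmul b n =>
      induction n with
      | zero => simp
      | add y z hy hz => simp only [TensorProduct.tmul_add, add_mul, map_add, hy, hz]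
      | tmul c d =>
        rw [QuasiBialgebra.counitL_tmul, AlgHom.comp_apply, AlgHom.comp_apply, includeRight_apply,
          includeRight_apply, tmul_mul_tmul, tmul_mul_tmul, mul_smul_comm]
        simp [key, contract_mul_comul, mul_assoc]

lemma contract₃_tmul_one_mul (q : A) (m : A ⊗[K] (A ⊗[K] A)) :
    contract₃ LinearMap.id H.β H.S.toLinearMap H.α LinearMap.id (q ⊗ₜ 1 * m) =
      q * contract₃ LinearMap.id H.β H.S.toLinearMap H.α LinearMap.id m := by
  induction m with
  | zero => simp
  | add y z hy hz => simp only [mul_add, map_add, hy, hz]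
  | tmul b n => simp [mul_assoc]

lemma mate_leg123 (τ : A) (w : A ⊗[K] (A ⊗[K] A)) :
    H.mate (contract₃ LinearMap.id H.β H.S.toLinearMap H.α LinearMap.id) τ (leg123 K w) =
      H.S H.α * H.twistMate τ w := by
  induction w with
  | zero => simp
  | add y z hy hz => simp only [mul_add, map_add, hy, hz]
  | tmul a m =>
    induction m with
    | zero => simp
    | add y z hy hz => simp only [TensorProduct.tmul_add, mul_add, map_add, hy, hz]
    | tmul b c => simp [H.S_mul, mul_assoc]

/-- Rearranges the pentagon so that each coproduct factor stands on the side where the functional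
absorbs it. -/
lemma mul_eq_mul_of_mul_eq {Q : Type*} [Monoid Q] {c c' d f m g g' : Q}
    (h : c * d = f * m * g) (hc : c' * c = 1) (hg : g * g' = 1) : d * g' = c' * (f * m) := by
  calc d * g' = c' * c * d * g' := by rw [hc, one_mul]
    _ = c' * (f * m) * (g * g') := by rw [mul_assoc c', h]; simp only [mul_assoc]
    _ = c' * (f * m) := by rw [hg, mul_one]

lemma map_inv_mul_map {P Q : Type*} [Semiring P] [Algebra K P] [Semiring Q] [Algebra K Q]
    (f : P →ₐ[K] Q) (x : Pˣ) : f (↑x⁻¹ : P) * f x = 1 := by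
  rw [← map_mul, Units.inv_mul, map_one]

lemma map_mul_map_inv {P Q : Type*} [Semiring P] [Algebra K P] [Semiring Q] [Algebra K Q]
    (f : P →ₐ[K] Q) (x : Pˣ) : f x * f (↑x⁻¹ : P) = 1 := by
  rw [← map_mul, Units.mul_inv, map_one]

/-- The zigzag relation: `S(α) ∑ S(Ȳ β S(Z̄)) τ X̄ = τ` if `S(a₍₂₎) τ a₍₁₎ = ε(a) τ`. -/
lemma S_α_mul_twistMate {τ : A} (hτ : ∀ a,
    contract₂ H.S.toLinearMap τ LinearMap.id (swap K (H.comul a)) = H.counit a • τ) :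
    H.S H.α * H.twistMate τ (↑H.Φ⁻¹ : A ⊗[K] (A ⊗[K] A)) = τ := by
  let G := contract₃ LinearMap.id H.β H.S.toLinearMap H.α LinearMap.id
  have hg : leg123 K (H.Φ : A ⊗[K] (A ⊗[K] A)) * leg123 K (↑H.Φ⁻¹ : A ⊗[K] (A ⊗[K] A)) = 1 :=
    map_mul_map_inv (leg123 K) H.Φ
  have h := congrArg (H.mate G τ) (mul_eq_mul_of_mul_eq H.pentagon
    (map_inv_mul_map (map (AlgHom.id K A) (map (AlgHom.id K A) H.comul)) H.Φ) hg)
  -- `(Δ ⊗ id ⊗ id)(Φ)` is absorbed by `τ`, `(id ⊗ Δ ⊗ id)(Φ)` by `β`, and `(id ⊗ id ⊗ Δ)(Φ⁻¹)` by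
  -- `α`.
  have hD := H.mate_comul_mul (G := G) H.contract₃_tmul_one_mul hτ H.counit_leg1
    (leg123 K (↑H.Φ⁻¹ : A ⊗[K] (A ⊗[K] A)))
  have hM := H.mate_mul_map (G := G) H.contract₃_mul_comul τ H.counit_leg2 (leg234 K H.Φ)
  have hC := H.mate_map_mul (G := G) H.contract₃_comul_mul τ
    (QuasiBialgebra.map_inv_eq_one _ _ H.counit_leg3)
    (leg234 K H.Φ * map (AlgHom.id K A) ((reassoc K A).comp (map H.comul (AlgHom.id K A))) H.Φ)
  have hF : H.mate G τ (leg234 K H.Φ) = τ := by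
    rw [leg234_apply, mate_tmul, H.duality, H.S_one, one_mul, mul_one]
  rw [← mate_leg123]
  exact hD.symm.trans (h.trans (hC.trans (hM.trans hF)))

end

end QuasiHopfAlgebra

/-! ### The Drinfel'd element and the monodromy. -/

namespace QuasitriangularQuasiHopfAlgebra

open QuasiHopf Algebra.TensorProduct

section

variable {K A : Type*} [Field K] [Ring A] [Algebra K A] (H : QuasitriangularQuasiHopfAlgebra K A)

/-- Swapping `R Δ(a) = Δᶜᵒᵖ(a) R` gives `R' Δᶜᵒᵖ(a) = Δ(a) R'`, and `α` absorbs `Δ(a)`. -/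
lemma contract_evalTwist_swap_comul (a : A) :
    contract₂ H.S.toLinearMap H.evalTwist LinearMap.id (swap K (H.comul a)) =
      H.counit a • H.evalTwist := by
  have hs : swap K (swap K (H.comul a)) = H.comul a := by
    generalize H.comul a = t
    induction t with
    | zero => simp
    | add y z hy hz => simp only [map_add, hy, hz]
    | tmul x y => simp
  rw [evalTwist, ← H.contract_mul_left, ← map_mul, ← H.quasi_cocomm, map_mul, hs,
    H.contract_comul_mul]

lemma drinfeld_mul (a : A) : H.drinfeld * a = H.S (H.S a) * H.drinfeld :=
  H.twistMate_mul H.contract_evalTwist_swap_comul a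

lemma S_α_mul_drinfeld : H.S H.α * H.drinfeld = H.evalTwist :=
  H.S_α_mul_twistMate H.contract_evalTwist_swap_comul

lemma S_drinfeld_mul (a : A) : H.S H.drinfeld * H.S (H.S a) = a * H.S H.drinfeld := by
  obtain ⟨b, rfl⟩ := H.S.surjective a
  rw [← H.S_mul, ← H.S_mul, drinfeld_mul]

lemma S_drinfeld_mul_drinfeld_central (a : A) :
    H.S H.drinfeld * H.drinfeld * a = a * (H.S H.drinfeld * H.drinfeld) := by
  rw [mul_assoc, drinfeld_mul, ← mul_assoc, S_drinfeld_mul, mul_assoc]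

lemma drinfeld_mul_S_drinfeld_central (a : A) :
    H.drinfeld * H.S H.drinfeld * a = a * (H.drinfeld * H.S H.drinfeld) := by
  obtain ⟨b, rfl⟩ := H.S.surjective a
  obtain ⟨c, rfl⟩ := H.S.surjective b
  rw [mul_assoc, S_drinfeld_mul, ← mul_assoc, drinfeld_mul, mul_assoc]

/-- `∑ S(x) α y = S(u) u α`, where `R'R = ∑ x ⊗ y`. -/
lemma contract_monodromy :
    contract₂ H.S.toLinearMap H.α LinearMap.id (H.monodromy : A ⊗[K] A) =
      H.S H.drinfeld * H.drinfeld * H.α := by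
  have key : ∀ w : A ⊗[K] A,
      contract₂ H.S.toLinearMap (H.S H.α * H.drinfeld) LinearMap.id w =
        H.S (contract₂ H.S.toLinearMap H.α LinearMap.id (swap K w)) * H.drinfeld := fun w => by
    induction w with
    | zero => simp
    | add y z hy hz => simp only [map_add, add_mul, hy, hz]
    | tmul x y => simp [H.S_mul, mul_assoc, drinfeld_mul]
  have hm : (H.monodromy : A ⊗[K] A) = swap K (H.R : A ⊗[K] A) * H.R := rfl
  -- Contracting `R'` gives `τ = S(α) u`. Contracting `R` around it gives `S(τ) u = S(u) S²(α) u =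
  -- S(u) u α`.
  rw [hm, H.contract_mul_left, ← evalTwist, ← S_α_mul_drinfeld, key, ← evalTwist,
    ← S_α_mul_drinfeld, H.S_mul, mul_assoc, mul_assoc, drinfeld_mul]

lemma counitL_monodromy : H.counitL A (H.monodromy : A ⊗[K] A) = 1 := by
  have hs : ∀ t, H.counitL A (swap K t) = H.counitR A t := fun t => by
    induction t with
    | zero => simp
    | add y z hy hz => simp only [map_add, hy, hz]
    | tmul x y => simp
  have hm : (H.monodromy : A ⊗[K] A) = swap K (H.R : A ⊗[K] A) * H.R := rfl
  rw [hm, map_mul, hs, counitR_R, counitL_R, one_mul]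

/-- A central element fixed by `S` with `ε(v) = 1` and `Δ(v) = m (v ⊗ v)` satisfies
`α = v² ∑ S(x) α y`, where `m = ∑ x ⊗ y`. -/
lemma α_eq_of_comul_eq {v : A} {m : A ⊗[K] A} (hc : ∀ a, v * a = a * v) (hS : H.S v = v)
    (hε : H.counit v = 1) (hΔ : H.comul v = m * (v ⊗ₜ[K] v)) :
    H.α = v ^ 2 * contract₂ H.S.toLinearMap H.α LinearMap.id m := by
  have h := H.antipode_left v
  rw [hε, one_smul, hΔ, H.contract_mul_left, contract₂_tmul] at h
  set X := contract₂ H.S.toLinearMap H.α LinearMap.id m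
  rw [← h, sq, mul_assoc v v X, hc X, ← mul_assoc]
  simp [hS]

/-! ### Ribbon elements. -/

variable {H}

/-- Since `(ε ⊗ id)(R'R) = 1`, applying `ε ⊗ id` to `Δ(v)` gives `v = ε(v) v`, and `v ≠ 0` over a
field. -/
lemma IsRibbon.counit_eq {v : A} (hv : H.IsRibbon v) : H.counit v = 1 := by
  have h := H.counitL_comul v
  rw [hv.comul_eq, map_mul, counitL_monodromy, one_mul, QuasiBialgebra.counitL_tmul] at h
  have h' : (H.counit v - 1) • v = 0 := by rw [sub_smul, one_smul, h, sub_self]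
  exact sub_eq_zero.mp ((smul_eq_zero.mp h').resolve_right hv.ne_zero)

lemma sq_central {v : A} (hc : ∀ a, v * a = a * v) (a : A) : v ^ 2 * a = a * v ^ 2 :=
  ((show Commute v a from hc a).pow_left 2).eq

lemma isUnit_of_sq_mul_eq_one {v q : A} (hc : ∀ a, v * a = a * v) (h : v ^ 2 * q = 1) :
    IsUnit v := by
  have h1 : v * (v * q) = 1 := by rw [← mul_assoc, ← sq, h]
  exact ⟨⟨v, v * q, h1, by rw [← hc, h1]⟩, rfl⟩

lemma IsRibbon.sq_mul {v : A} (hv : H.IsRibbon v) :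
    v ^ 2 * (H.S H.drinfeld * H.drinfeld) = 1 := by
  have h := H.α_eq_of_comul_eq hv.central hv.S_eq hv.counit_eq hv.comul_eq
  rw [contract_monodromy, ← mul_assoc] at h
  have hz : ∀ a, v ^ 2 * (H.S H.drinfeld * H.drinfeld) * a =
      a * (v ^ 2 * (H.S H.drinfeld * H.drinfeld)) := fun a => by
    rw [mul_assoc, S_drinfeld_mul_drinfeld_central, ← mul_assoc, sq_central hv.central, mul_assoc]
  have := H.mul_contract_eq_one_of_α_eq hz h
  rwa [H.duality, mul_one] at this

lemma IsRibbon.isUnit {v : A} (hv : H.IsRibbon v) : IsUnit v :=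
  isUnit_of_sq_mul_eq_one hv.central hv.sq_mul

lemma IsRibbon.sq_mul' {v : A} (hv : H.IsRibbon v) :
    v ^ 2 * (H.drinfeld * H.S H.drinfeld) = 1 := by
  have h := hv.sq_mul
  have hc := sq_central hv.central
  set u := H.drinfeld
  set e := v ^ 2 * (u * H.S u)
  have he : ∀ a, e * a = a * e := fun a => by
    rw [mul_assoc, drinfeld_mul_S_drinfeld_central, ← mul_assoc, hc, mul_assoc]
  -- `v² S(u)` is a left inverse of `u`. Since `e` is central, this expression equals both `e` and
  -- the square of `v² S(u) u = 1`.
  have h1 : v ^ 2 * H.S u * (e * u) = 1 := by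
    calc _ = v ^ 2 * (H.S u * (v ^ 2 * u)) * (H.S u * u) := by simp only [e, mul_assoc]
      _ = v ^ 2 * (H.S u * u) * (v ^ 2 * (H.S u * u)) := by rw [hc u]; simp only [mul_assoc, hc]
      _ = 1 := by rw [h, one_mul]
  calc e = e * (v ^ 2 * (H.S u * u)) := by rw [h, mul_one]
    _ = v ^ 2 * H.S u * (e * u) := by rw [he, he]; simp only [mul_assoc]
    _ = 1 := h1

/-- Both sides invert `Δ(x)`, because `x ⊗ x` is central and commutes past `m`. -/
lemma comul_inv_eq {x : Aˣ} {m : (A ⊗[K] A)ˣ} (hc : ∀ a : A, (x : A) * a = a * x)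
    (h : H.comul x = (m : A ⊗[K] A) * ((x : A) ⊗ₜ[K] (x : A))) :
    H.comul (↑x⁻¹ : A) = (↑m⁻¹ : A ⊗[K] A) * ((↑x⁻¹ : A) ⊗ₜ[K] (↑x⁻¹ : A)) := by
  have hxx : ∀ t : A ⊗[K] A, ((x : A) ⊗ₜ[K] (x : A)) * t = t * ((x : A) ⊗ₜ[K] (x : A)) :=
    fun t => by
      induction t with
      | zero => simp
      | add y z hy hz => simp only [mul_add, add_mul, hy, hz]
      | tmul a b => simp [hc]
  have h1 : H.comul (↑x⁻¹ : A) * H.comul x = 1 := by rw [← map_mul, Units.inv_mul, map_one]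
  have h2 : H.comul x * ((↑m⁻¹ : A ⊗[K] A) * ((↑x⁻¹ : A) ⊗ₜ[K] (↑x⁻¹ : A))) = 1 := by
    rw [h, ← hxx, mul_assoc, Units.mul_inv_cancel_left, tmul_mul_tmul, Units.mul_inv, one_def]
  exact left_inv_eq_right_inv h1 h2

lemma S_inv_eq {x : Aˣ} (h : H.S x = x) : H.S (↑x⁻¹ : A) = (↑x⁻¹ : A) := by
  have h1 : H.S (↑x⁻¹ : A) * x = 1 := by
    conv_lhs => rw [← h]
    rw [← H.S_mul, Units.mul_inv, H.S_one]
  exact Units.eq_inv_of_mul_eq_one_right h1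

lemma inv_central {x : Aˣ} (h : ∀ a : A, (x : A) * a = a * x) (a : A) :
    (↑x⁻¹ : A) * a = a * (↑x⁻¹ : A) :=
  ((show Commute (x : A) a from h a).units_inv_left).eq

lemma isRibbon_iff_isRibbonBPO_inv (x : Aˣ) : H.IsRibbon (x : A) ↔ H.IsRibbonBPO (↑x⁻¹ : A) := by
  constructor
  · intro h
    exact ⟨x⁻¹.isUnit, inv_central h.central, comul_inv_eq h.central h.comul_eq, S_inv_eq h.S_eq⟩
  · intro h
    -- The counit is a ring homomorphism to a field, so `1 ≠ 0` in `A` and units are nonzero.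
    have : Nontrivial A := H.counit.toRingHom.domain_nontrivial
    refine ⟨x.ne_zero, ?_, ?_, ?_⟩
    · simpa using inv_central h.central
    · simpa using comul_inv_eq h.central h.comul_eq
    · simpa using S_inv_eq h.S_eq

lemma isRibbonAC_iff_isRibbonBPO (w : A) : H.IsRibbonAC w ↔ H.IsRibbonBPO w := by
  constructor
  · intro h
    refine ⟨?_, h.central, h.comul_eq, h.S_eq⟩
    -- With `m = (R'R)⁻¹`, the relation `α = w² X` and duality give `w²` a right inverse; the value
    -- of `X` is not needed.
    exact isUnit_of_sq_mul_eq_one h.central <| H.mul_contract_eq_one_of_α_eq (sq_central h.central)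
      (H.α_eq_of_comul_eq h.central h.S_eq h.counit_eq h.comul_eq)
  · intro h
    obtain ⟨x, rfl⟩ := h.isUnit
    have hr : H.IsRibbon (↑x⁻¹ : A) := (isRibbon_iff_isRibbonBPO_inv x⁻¹).2 (by rwa [inv_inv])
    refine ⟨h.central, ?_, h.S_eq, ?_, h.comul_eq⟩
    · have h1 := congrArg ((x : A) ^ 2 * ·) hr.sq_mul'
      simp only [← mul_assoc, mul_one] at h1
      rw [← h1, ← Units.val_pow_eq_pow_val, ← Units.val_pow_eq_pow_val, ← Units.val_mul]
      simp
    · have h1 : H.counit (↑x⁻¹ : A) * H.counit x = 1 := by rw [← map_mul, Units.inv_mul, map_one]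
      rwa [hr.counit_eq, one_mul] at h1

end

end QuasitriangularQuasiHopfAlgebra

theorem theorem2p3 {K A : Type*} [Field K] [Ring A] [Algebra K A]
    (H : QuasitriangularQuasiHopfAlgebra K A) :
    (∀ v : A, H.IsRibbon v →
      ∃ x : Aˣ, (x : A) = v ∧ (↑(x ^ (-2 : ℤ)) : A) = H.drinfeld * H.S H.drinfeld) ∧
    (∀ x : Aˣ, H.IsRibbon (x : A) ↔ H.IsRibbonBPO (↑x⁻¹ : A)) ∧
    (∀ w : A, H.IsRibbonAC w ↔ H.IsRibbonBPO w) := by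
  refine ⟨fun v hv => ?_, QuasitriangularQuasiHopfAlgebra.isRibbon_iff_isRibbonBPO_inv,
    QuasitriangularQuasiHopfAlgebra.isRibbonAC_iff_isRibbonBPO⟩
  obtain ⟨x, rfl⟩ := hv.isUnit
  refine ⟨x, rfl, ?_⟩
  have h : (↑(x ^ 2) : A) * (H.drinfeld * H.S H.drinfeld) = 1 := by
    rw [Units.val_pow_eq_pow_val, hv.sq_mul']
  rw [zpow_neg]
  exact Units.inv_eq_of_mul_eq_one_right h
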